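/- Let $\sigma_c,\sigma_z,\epsilon\ge 0$. For $1\le d\le n$ and $U\in\mathbb R^{n\times d}$ with $U^TU=I_d$, consider the signal $x=Uc$ with $c\sim\mathcal N(0,\tfrac{\sigma_c^2}{d}I_d)$ and the measurement $y=x+z$ with independent noise $z\sim\mathcal N(0,\tfrac{\sigma_z^2}{n}I_n)$. For $H\in\mathbb R^{n\times n}$ let $$R_\epsilon(H)=\mathbb E_{c,z}\Big[\max_{\|e\|_2\le\epsilon}\|H(x+z+e)-x\|_2^2\Big]$$ be the worst-case robust risk of the linear estimator $f(y)=Hy$, and put $$\alpha=\alpha(d/n)=\begin{cases}\dfrac{\sigma_c^2-\dfrac{\epsilon\,\sigma_c\sigma_z\sqrt{d/n}}{\sqrt{\sigma_c^2+\sigma_z^2\frac dn-\epsilon^2}}}{\sigma_c^2+\sigma_z^2\frac dn}&\text{if }\sigma_c^2>\epsilon^2,\\[2ex]0&\text{otherwise.}\end{cases}$$ Then, as $d\to\infty$, the minimizer of $R_\epsilon$ among symmetric matrices $H$ is $H=\alpha UU^T$, in the following sense. (i) The estimator $\alpha UU^T$ is asymptotically optimal: for every $\delta>0$ there is a $D$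 (depending only on $\delta,\sigma_c,\sigma_z,\epsilon$) such that for all $d\ge D$, all $n\ge d$, all $U$ as above and all symmetric $H$, $R_\epsilon(\alpha UU^T)\le R_\epsilon(H)+\delta$. (ii) If $\sigma_z>0$, the minimizer converges to $\alpha UU^T$: for every $\delta>0$ and every $K$ there is a $D$ (depending only on $\delta,K,\sigma_c,\sigma_z,\epsilon$) such that for all $d\ge D$, all $n\ge d$ (with $n\le Kd$ in the borderline case $\epsilon=\sigma_c$) and all $U$ as above, $R_\epsilon$ has a unique minimizer over the symmetric matrices $H$, and it equals $a\,UU^T$ for some real $a$ with $|a-\alpha|\le\delta$. -/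

import Mathlib

open MeasureTheory ProbabilityTheory

noncomputable section

/-- The centred isotropic Gaussian law `N(0, v I)` on `ℝ^k`. -/
def isoGaussian (k : ℕ) (v : ℝ) : Measure (EuclideanSpace ℝ (Fin k)) :=
  multivariateGaussian 0 (v • (1 : Matrix (Fin k) (Fin k) ℝ))

/-- The joint law of the latent vector `c ~ N(0, σc²/d I_d)` and the independent measurement noise
`z ~ N(0, σz²/n I_n)`. -/
def modelLaw (n d : ℕ) (σc σz : ℝ) :
    Measure (EuclideanSpace ℝ (Fin d) × EuclideanSpace ℝ (Fin n)) :=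
  (isoGaussian d (σc ^ 2 / d)).prod (isoGaussian n (σz ^ 2 / n))

/-- The linear estimator `f(y) = H y`. -/
def linEst {n : ℕ} (H : Matrix (Fin n) (Fin n) ℝ) :
    EuclideanSpace ℝ (Fin n) → EuclideanSpace ℝ (Fin n) :=
  fun y ↦ Matrix.toEuclideanLin H y

/-- The worst-case squared error `max_{‖e‖ ≤ ε} ‖f (x + z + e) - x‖²` of the estimator `f`
for the signal `x` and the noise `z`. -/
def worstCaseError {n : ℕ} (ε : ℝ) (f : EuclideanSpace ℝ (Fin n) → EuclideanSpace ℝ (Fin n))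
    (x z : EuclideanSpace ℝ (Fin n)) : ℝ :=
  ⨆ e : Metric.closedBall (0 : EuclideanSpace ℝ (Fin n)) ε,
    ‖f (x + z + (e : EuclideanSpace ℝ (Fin n))) - x‖ ^ 2

/-- The `ℓ²` worst-case robust risk `R_ε(f)` of the estimator `f` for denoising `y = x + z`,
where `x = U c`. -/
def robustRisk {n d : ℕ} (U : Matrix (Fin n) (Fin d) ℝ) (σc σz ε : ℝ)
    (f : EuclideanSpace ℝ (Fin n) → EuclideanSpace ℝ (Fin n)) : ℝ :=
  ∫ p, worstCaseError ε f (Matrix.toEuclideanLin U p.1) p.2 ∂(modelLaw n d σc σz)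

/-- The shrinkage factor `α`, as a function of `σc`, `σz`, `ε` and the ratio `r = d/n`. -/
def shrinkage (σc σz ε r : ℝ) : ℝ :=
  if ε ^ 2 < σc ^ 2 then
    (σc ^ 2 - ε * σc * σz * √r / √(σc ^ 2 + σz ^ 2 * r - ε ^ 2)) / (σc ^ 2 + σz ^ 2 * r)
  else 0

/-- For a linear estimator the worst-case error is an attained maximum. -/
theorem worstCaseError_isGreatest {n : ℕ} {ε : ℝ} (hε : 0 ≤ ε) (H : Matrix (Fin n) (Fin n) ℝ)
    (x z : EuclideanSpace ℝ (Fin n)) :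
    IsGreatest ((fun e ↦ ‖linEst H (x + z + e) - x‖ ^ 2) '' Metric.closedBall 0 ε)
      (worstCaseError ε (linEst H) x z) := by
  have hc : IsCompact ((fun e ↦ ‖linEst H (x + z + e) - x‖ ^ 2) ''
      Metric.closedBall (0 : EuclideanSpace ℝ (Fin n)) ε) := by
    refine (isCompact_closedBall _ _).image ?_
    have : Continuous (linEst H) := LinearMap.continuous_of_finiteDimensional _
    fun_prop
  have := hc.isGreatest_sSup ((Metric.nonempty_closedBall.2 hε).image _)
  rwa [sSup_image'] at this

/-- For a linear estimator the worst-case error is integrable, so that the robust risk is a genuine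
expectation. -/
theorem worstCaseError_integrable {n d : ℕ} (U : Matrix (Fin n) (Fin d) ℝ) (σc σz : ℝ) {ε : ℝ}
    (hε : 0 ≤ ε) (H : Matrix (Fin n) (Fin n) ℝ) :
    Integrable (fun p : EuclideanSpace ℝ (Fin d) × EuclideanSpace ℝ (Fin n) ↦
      worstCaseError ε (linEst H) (Matrix.toEuclideanLin U p.1) p.2) (modelLaw n d σc σz) := by
  have hH : Continuous (linEst H) := LinearMap.continuous_of_finiteDimensional _
  have hU : Continuous (Matrix.toEuclideanLin U) := LinearMap.continuous_of_finiteDimensional _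
  have hcont : Continuous (fun p : EuclideanSpace ℝ (Fin d) × EuclideanSpace ℝ (Fin n) ↦
      worstCaseError ε (linEst H) (Matrix.toEuclideanLin U p.1) p.2) := by
    have := (isCompact_closedBall (0 : EuclideanSpace ℝ (Fin n)) ε).continuous_sSup
      (f := fun (p : EuclideanSpace ℝ (Fin d) × EuclideanSpace ℝ (Fin n)) e ↦
        ‖linEst H (Matrix.toEuclideanLin U p.1 + p.2 + e) - Matrix.toEuclideanLin U p.1‖ ^ 2)
      (by fun_prop)
    simpa only [worstCaseError, sSup_image'] using this
  obtain ⟨A, hA0, hA⟩ : ∃ A : ℝ, 0 ≤ A ∧ ∀ v, ‖linEst H v‖ ≤ A * ‖v‖ :=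
    ⟨‖LinearMap.toContinuousLinearMap (Matrix.toEuclideanLin H)‖, norm_nonneg _,
      (LinearMap.toContinuousLinearMap (Matrix.toEuclideanLin H)).le_opNorm⟩
  obtain ⟨B, hB0, hB⟩ : ∃ B : ℝ, 0 ≤ B ∧ ∀ v, ‖Matrix.toEuclideanLin U v‖ ≤ B * ‖v‖ :=
    ⟨‖LinearMap.toContinuousLinearMap (Matrix.toEuclideanLin U)‖, norm_nonneg _,
      (LinearMap.toContinuousLinearMap (Matrix.toEuclideanLin U)).le_opNorm⟩
  have hid : ∀ (k : ℕ) (v : ℝ), MemLp (fun x ↦ ‖x‖) 2 (isoGaussian k v) := fun k v ↦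
    (IsGaussian.memLp_id (multivariateGaussian _ _) 2 (by simp)).norm
  have : IsProbabilityMeasure (isoGaussian d (σc ^ 2 / d)) := by
    unfold isoGaussian; infer_instance
  have : IsProbabilityMeasure (isoGaussian n (σz ^ 2 / n)) := by
    unfold isoGaussian; infer_instance
  have h1 : MemLp (fun p : EuclideanSpace ℝ (Fin d) × EuclideanSpace ℝ (Fin n) ↦ ‖p.1‖) 2
      (modelLaw n d σc σz) :=
    (hid d _).comp_measurePreserving measurePreserving_fst
  have h2 : MemLp (fun p : EuclideanSpace ℝ (Fin d) × EuclideanSpace ℝ (Fin n) ↦ ‖p.2‖) 2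
      (modelLaw n d σc σz) :=
    (hid n _).comp_measurePreserving measurePreserving_snd
  have : IsProbabilityMeasure (modelLaw n d σc σz) := by
    unfold modelLaw; infer_instance
  have h3 : MemLp (fun _ : EuclideanSpace ℝ (Fin d) × EuclideanSpace ℝ (Fin n) ↦ A * ε) 2
      (modelLaw n d σc σz) := memLp_const _
  refine (((h1.const_mul (A * B + B)).add (h2.const_mul A)).add h3).integrable_sq.mono'
    hcont.aestronglyMeasurable (ae_of_all _ fun p ↦ ?_)
  obtain ⟨⟨e, he, hmax⟩, -⟩ :=
    worstCaseError_isGreatest hε H (Matrix.toEuclideanLin U p.1) p.2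
  rw [← hmax]
  simp only [Real.norm_eq_abs, abs_pow, abs_norm, Pi.add_apply]
  have he' : ‖e‖ ≤ ε := by simpa using he
  refine pow_le_pow_left₀ (norm_nonneg _) ?_ 2
  calc _ ≤ A * (B * ‖p.1‖ + ‖p.2‖ + ε) + B * ‖p.1‖ :=
        (norm_sub_le _ _).trans (add_le_add ((hA _).trans (mul_le_mul_of_nonneg_left
          ((norm_add_le _ _).trans (add_le_add ((norm_add_le _ _).trans
            (add_le_add_left (hB _) _)) he')) hA0)) (hB _))
    _ = _ := by ring

end

/-! ### Transposes and isometries on Euclidean space -/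

/-! Two symmetrizations reduce the problem to one scalar. The reflection `2UUᵀ - 1` fixes the range
of `U`, negates the noise orthogonal to it and preserves the noise law. Averaging the error over it
(`robustRisk_compression_le`) compresses `H` to `G = UᵀHU` in a square model of dimension `d` with
noise parameter `τ = σz√(d/n)`. That model is invariant under orthogonal conjugation and its risk is
convex in the matrix, so averaging `G` over signed cyclic shifts (`robustRisk_trace_smul_one_le`)
leaves `(tr G / d) I`. Hence no `H` beats `a UUᵀ` with `a = tr G / d`.

For `a UUᵀ` the worst perturbation is aligned with `v = (a-1)c + aUᵀz`, so the error is `(‖v‖ +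
ε|a|)²`. Here `v` is isotropic Gaussian with `E‖v‖² = V(a) = (a-1)²σc² + a²τ²` and `E‖v‖ = κ√V(a)`,
where `κ = meanNormRatio d → 1`. The risk `P(a)` therefore satisfies `κ L(a) ≤ P(a) ≤ L(a)` with
`L(a) = (√V(a) + ε|a|)²`. The factor `α` minimizes `L`, and `L(α) ≤ L(0) = σc²`, so the loss is at
most `(1-κ)σc²`, uniformly in `n` and `U`.

For (ii), `L` grows quadratically around `α` (`exists_quadratic_growth`), which forces minimizers of
`P` towards `α`. Uniqueness among matrices is strict midpoint convexity (`robustRisk_midpoint_lt`),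
which holds because nondegenerate Gaussian noise is unbounded. -/

theorem inner_toEuclideanLin_left {m n : ℕ} (A : Matrix (Fin m) (Fin n) ℝ)
    (x : EuclideanSpace ℝ (Fin n)) (y : EuclideanSpace ℝ (Fin m)) :
    inner ℝ (Matrix.toEuclideanLin A x) y = inner ℝ x (Matrix.toEuclideanLin A.transpose y) := by
  rw [← Matrix.conjTranspose_eq_transpose_of_trivial,
    Matrix.toEuclideanLin_conjTranspose_eq_adjoint, LinearMap.adjoint_inner_right]

theorem toEuclideanLin_mul_apply {l m n : ℕ} (A : Matrix (Fin l) (Fin m) ℝ)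
    (B : Matrix (Fin m) (Fin n) ℝ) (x : EuclideanSpace ℝ (Fin n)) :
    Matrix.toEuclideanLin (A * B) x = Matrix.toEuclideanLin A (Matrix.toEuclideanLin B x) := by
  simp

theorem toEuclideanLin_one_apply {n : ℕ} (x : EuclideanSpace ℝ (Fin n)) :
    Matrix.toEuclideanLin (1 : Matrix (Fin n) (Fin n) ℝ) x = x := by
  simp

theorem continuous_toEuclideanLin {m n : ℕ} (A : Matrix (Fin m) (Fin n) ℝ) :
    Continuous (Matrix.toEuclideanLin A) :=
  LinearMap.continuous_of_finiteDimensional _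

theorem transpose_toEuclideanLin_apply_self {m n : ℕ} {U : Matrix (Fin m) (Fin n) ℝ}
    (hU : U.transpose * U = 1) (x : EuclideanSpace ℝ (Fin n)) :
    Matrix.toEuclideanLin U.transpose (Matrix.toEuclideanLin U x) = x := by
  rw [← toEuclideanLin_mul_apply, hU, toEuclideanLin_one_apply]

theorem norm_toEuclideanLin_of_transpose_mul_self {m n : ℕ} {U : Matrix (Fin m) (Fin n) ℝ}
    (hU : U.transpose * U = 1) (x : EuclideanSpace ℝ (Fin n)) :
    ‖Matrix.toEuclideanLin U x‖ = ‖x‖ := by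
  rw [← sq_eq_sq₀ (norm_nonneg _) (norm_nonneg _), ← real_inner_self_eq_norm_sq,
    inner_toEuclideanLin_left, transpose_toEuclideanLin_apply_self hU, real_inner_self_eq_norm_sq]

theorem norm_toEuclideanLin_transpose_le {m n : ℕ} {U : Matrix (Fin m) (Fin n) ℝ}
    (hU : U.transpose * U = 1) (x : EuclideanSpace ℝ (Fin m)) :
    ‖Matrix.toEuclideanLin U.transpose x‖ ≤ ‖x‖ := by
  have h : ‖Matrix.toEuclideanLin U.transpose x‖ ^ 2 ≤
      ‖x‖ * ‖Matrix.toEuclideanLin U.transpose x‖ := by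
    conv_rhs => rw [← norm_toEuclideanLin_of_transpose_mul_self hU]
    rw [← real_inner_self_eq_norm_sq, inner_toEuclideanLin_left, Matrix.transpose_transpose]
    exact real_inner_le_norm _ _
  by_contra! hlt
  nlinarith [norm_nonneg x]

/-! ### Isotropic Gaussian laws -/

instance isProbabilityMeasure_isoGaussian (k : ℕ) (v : ℝ) :
    IsProbabilityMeasure (isoGaussian k v) := by
  unfold isoGaussian; infer_instance

instance isProbabilityMeasure_modelLaw (n d : ℕ) (σc σz : ℝ) :
    IsProbabilityMeasure (modelLaw n d σc σz) := by
  unfold modelLaw; infer_instance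

theorem posSemidef_smul_one (k : ℕ) {v : ℝ} (hv : 0 ≤ v) :
    (v • (1 : Matrix (Fin k) (Fin k) ℝ)).PosSemidef :=
  Matrix.PosSemidef.one.smul hv

theorem charFun_isoGaussian (k : ℕ) {v : ℝ} (hv : 0 ≤ v) (t : EuclideanSpace ℝ (Fin k)) :
    charFun (isoGaussian k v) t = Complex.exp (-((v * ‖t‖ ^ 2 / 2 : ℝ) : ℂ)) := by
  rw [isoGaussian, charFun_multivariateGaussian (posSemidef_smul_one k hv)]
  congr 1
  rw [Matrix.smul_mulVec, Matrix.one_mulVec, dotProduct_smul, EuclideanSpace.real_norm_sq_eq]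
  simp [dotProduct, pow_two]

/-- The characteristic function of `Uᵀz` at `t` is that of `z` at `Ut`, and it depends only on `‖Ut‖
= ‖t‖`. -/
theorem isoGaussian_map_transpose {n d : ℕ} {U : Matrix (Fin n) (Fin d) ℝ}
    (hU : U.transpose * U = 1) {v : ℝ} (hv : 0 ≤ v) :
    (isoGaussian n v).map (Matrix.toEuclideanLin U.transpose) = isoGaussian d v := by
  have hm : Measurable (Matrix.toEuclideanLin U.transpose) :=
    (continuous_toEuclideanLin _).measurable
  have := Measure.isProbabilityMeasure_map (μ := isoGaussian n v) hm.aemeasurable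
  refine Measure.ext_of_charFun (funext fun t ↦ ?_)
  rw [charFun_isoGaussian d hv, ← norm_toEuclideanLin_of_transpose_mul_self hU,
    ← charFun_isoGaussian n hv, charFun_apply, charFun_apply,
    integral_map hm.aemeasurable (by fun_prop)]
  simp_rw [inner_toEuclideanLin_left, Matrix.transpose_transpose]

theorem isoGaussian_eq_map_smul_stdGaussian (k : ℕ) {v : ℝ} (hv : 0 ≤ v) :
    isoGaussian k v = (stdGaussian (EuclideanSpace ℝ (Fin k))).map (fun x ↦ √v • x) := by
  have := Measure.isProbabilityMeasure_map (μ := stdGaussian (EuclideanSpace ℝ (Fin k)))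
    (f := fun x ↦ √v • x) (by fun_prop)
  refine Measure.ext_of_charFun (funext fun t ↦ ?_)
  rw [charFun_isoGaussian k hv, charFun_map_smul, charFun_stdGaussian, norm_smul,
    ← Complex.ofReal_pow, mul_pow, Real.norm_eq_abs, sq_abs, Real.sq_sqrt hv]
  push_cast
  rw [neg_div]

theorem isoGaussian_prod_map_add {k : ℕ} {v w : ℝ} (hv : 0 ≤ v) (hw : 0 ≤ w) (p q : ℝ) :
    ((isoGaussian k v).prod (isoGaussian k w)).map (fun x ↦ p • x.1 + q • x.2) =
      isoGaussian k (p ^ 2 * v + q ^ 2 * w) := by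
  have hm : Measurable (fun x : EuclideanSpace ℝ (Fin k) × EuclideanSpace ℝ (Fin k) ↦
    p • x.1 + q • x.2) := by fun_prop
  have := Measure.isProbabilityMeasure_map
    (μ := (isoGaussian k v).prod (isoGaussian k w)) hm.aemeasurable
  refine Measure.ext_of_charFun (funext fun t ↦ ?_)
  rw [charFun_apply, integral_map hm.aemeasurable (by fun_prop)]
  simp_rw [inner_add_left, real_inner_smul_left, ← real_inner_smul_right, Complex.ofReal_add,
    add_mul, Complex.exp_add]
  rw [integral_prod_mul (fun x : EuclideanSpace ℝ (Fin k) ↦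
      Complex.exp ((inner ℝ x (p • t) : ℝ) * Complex.I))
    (fun x : EuclideanSpace ℝ (Fin k) ↦ Complex.exp ((inner ℝ x (q • t) : ℝ) * Complex.I)),
    ← charFun_apply, ← charFun_apply, charFun_isoGaussian k hv, charFun_isoGaussian k hw,
    charFun_isoGaussian k (by positivity), ← Complex.exp_add, norm_smul, norm_smul]
  congr 1
  push_cast
  simp only [mul_pow, ← Complex.ofReal_pow, Real.norm_eq_abs, sq_abs]
  push_cast
  ring

/-- The latent vector and the component of the noise in the range of `U` follow a square model. -/
theorem modelLaw_map_transpose {n d : ℕ} {U : Matrix (Fin n) (Fin d) ℝ} (hd : 0 < d)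
    (hU : U.transpose * U = 1) (σc σz : ℝ) :
    (modelLaw n d σc σz).map (Prod.map id (Matrix.toEuclideanLin U.transpose)) =
      modelLaw d d σc (σz * √((d : ℝ) / n)) := by
  have hm : Measurable (Matrix.toEuclideanLin U.transpose) :=
    (continuous_toEuclideanLin _).measurable
  -- Projection keeps the variance per coordinate; only its normalization changes from `n` to `d`.
  have hv : (σz * √((d : ℝ) / n)) ^ 2 / d = σz ^ 2 / n := by
    rw [mul_pow, Real.sq_sqrt (by positivity)]
    field_simp
  rw [modelLaw, modelLaw, hv, ← Measure.map_prod_map _ _ measurable_id hm, Measure.map_id,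
    isoGaussian_map_transpose hU (by positivity)]

/-- The model law is invariant under orthogonal transformations. -/
theorem modelLaw_map_orthogonal {n d : ℕ} {V : Matrix (Fin d) (Fin d) ℝ}
    {Q : Matrix (Fin n) (Fin n) ℝ} (hV : V * V.transpose = 1) (hQ : Q * Q.transpose = 1)
    (σc σz : ℝ) :
    (modelLaw n d σc σz).map (Prod.map (Matrix.toEuclideanLin V) (Matrix.toEuclideanLin Q)) =
      modelLaw n d σc σz := by
  have hV' := isoGaussian_map_transpose (U := V.transpose) (by simpa using hV)
    (v := σc ^ 2 / d) (by positivity)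
  have hQ' := isoGaussian_map_transpose (U := Q.transpose) (by simpa using hQ)
    (v := σz ^ 2 / n) (by positivity)
  rw [Matrix.transpose_transpose] at hV' hQ'
  rw [modelLaw, ← Measure.map_prod_map _ _ (continuous_toEuclideanLin V).measurable
    (continuous_toEuclideanLin Q).measurable, hV', hQ']

/-! ### Concentration of the norm of a Gaussian vector -/

/-- The ratio `E‖g‖ / √(E‖g‖²)` for a standard Gaussian vector `g` in `ℝ^k`. -/
noncomputable def meanNormRatio (k : ℕ) : ℝ :=
  (∫ x, ‖x‖ ∂(stdGaussian (EuclideanSpace ℝ (Fin k)))) / √k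

theorem memLp_sq_gaussianReal : MemLp (fun x : ℝ ↦ x ^ 2) 2 (gaussianReal 0 1) := by
  have h : MemLp (id : ℝ → ℝ) 4 (gaussianReal 0 1) := memLp_id_gaussianReal' 4 (by simp)
  have := MemLp.mul' (p := 4) (q := 4) (r := 2) h h
    (hpqr := ⟨by
      rw [← ENNReal.toReal_eq_toReal_iff' (by simp) (by simp), ENNReal.toReal_add (by simp) (by simp)]
      norm_num⟩)
  simpa [pow_two] using this

theorem integral_sq_gaussianReal : ∫ x, x ^ 2 ∂(gaussianReal 0 1) = 1 := by
  have := variance_of_integral_eq_zero (μ := gaussianReal 0 1) (X := fun x : ℝ ↦ x)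
    (by fun_prop) (by simp)
  rw [← this, variance_fun_id_gaussianReal]
  simp

theorem integral_norm_sq_stdGaussian (k : ℕ) :
    ∫ x, ‖x‖ ^ 2 ∂(stdGaussian (EuclideanSpace ℝ (Fin k))) = k := by
  rw [← map_pi_eq_stdGaussian, integral_map (by fun_prop) (by fun_prop)]
  simp_rw [EuclideanSpace.real_norm_sq_eq]
  rw [integral_finsetSum]
  · have (i : Fin k) : ∫ x : Fin k → ℝ, x i ^ 2 ∂(Measure.pi fun _ ↦ gaussianReal 0 1) = 1 := by
      rw [← integral_sq_gaussianReal]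
      exact integral_comp_eval (μ := fun _ : Fin k ↦ gaussianReal 0 1) (i := i)
        (f := fun x : ℝ ↦ x ^ 2) (by fun_prop)
    simp [this]
  · intro i _
    exact integrable_comp_eval (μ := fun _ : Fin k ↦ gaussianReal 0 1) (i := i)
        (f := fun x : ℝ ↦ x ^ 2) (memLp_sq_gaussianReal.integrable (by norm_num))

theorem variance_norm_sq_stdGaussian (k : ℕ) :
    Var[fun x ↦ ‖x‖ ^ 2; stdGaussian (EuclideanSpace ℝ (Fin k))] =
      k * Var[fun x ↦ x ^ 2; gaussianReal 0 1] := by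
  rw [← map_pi_eq_stdGaussian, variance_map (by fun_prop) (by fun_prop)]
  have : (fun x : EuclideanSpace ℝ (Fin k) ↦ ‖x‖ ^ 2) ∘ WithLp.toLp 2 =
      ∑ i, (fun x : Fin k → ℝ ↦ x i ^ 2) := by
    ext x
    simp [EuclideanSpace.real_norm_sq_eq]
  rw [this, variance_sum_pi (X := fun _ x ↦ x ^ 2) (fun _ ↦ memLp_sq_gaussianReal)]
  simp

theorem memLp_norm_sq_stdGaussian (k : ℕ) :
    MemLp (fun x ↦ ‖x‖ ^ 2) 2 (stdGaussian (EuclideanSpace ℝ (Fin k))) := by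
  have h : MemLp (fun x ↦ ‖x‖) 4 (stdGaussian (EuclideanSpace ℝ (Fin k))) :=
    (IsGaussian.memLp_id _ 4 (by simp)).norm
  have := MemLp.mul' (p := 4) (q := 4) (r := 2) h h
    (hpqr := ⟨by
      rw [← ENNReal.toReal_eq_toReal_iff' (by simp) (by simp), ENNReal.toReal_add (by simp) (by simp)]
      norm_num⟩)
  simpa [pow_two] using this

theorem integrable_norm_stdGaussian (k : ℕ) :
    Integrable (fun x ↦ ‖x‖) (stdGaussian (EuclideanSpace ℝ (Fin k))) :=
  IsGaussian.integrable_id.norm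

theorem integrable_norm_sq_stdGaussian (k : ℕ) :
    Integrable (fun x ↦ ‖x‖ ^ 2) (stdGaussian (EuclideanSpace ℝ (Fin k))) :=
  (memLp_norm_sq_stdGaussian k).integrable (by norm_num)

theorem meanNormRatio_nonneg (k : ℕ) : 0 ≤ meanNormRatio k :=
  div_nonneg (integral_nonneg fun _ ↦ norm_nonneg _) (Real.sqrt_nonneg _)

theorem meanNormRatio_le_one (k : ℕ) : meanNormRatio k ≤ 1 := by
  refine div_le_one_of_le₀ (Real.le_sqrt_of_sq_le ?_) (Real.sqrt_nonneg _)
  have h := variance_nonneg (fun x ↦ ‖x‖) (stdGaussian (EuclideanSpace ℝ (Fin k)))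
  have hL : MemLp (fun x ↦ ‖x‖) 2 (stdGaussian (EuclideanSpace ℝ (Fin k))) :=
    (IsGaussian.memLp_id _ 2 (by simp)).norm
  rw [variance_eq_sub hL] at h
  have h2 := integral_norm_sq_stdGaussian k
  simp only [Pi.pow_apply] at h
  linarith

/-- The Taylor coefficient `-1/8` is weakened to `-1/2` to get a bound on all of `[0, ∞)`: with `t =
u²` the gap is `u(u+2)(u-1)²/2`. -/
theorem sqrt_ge_quadratic {t : ℝ} (ht : 0 ≤ t) :
    1 + (t - 1) / 2 - (t - 1) ^ 2 / 2 ≤ √t := by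
  obtain ⟨u, hu, rfl⟩ : ∃ u : ℝ, 0 ≤ u ∧ u ^ 2 = t := ⟨√t, Real.sqrt_nonneg _, Real.sq_sqrt ht⟩
  rw [Real.sqrt_sq hu]
  nlinarith [mul_nonneg hu (mul_nonneg (add_nonneg hu zero_le_two) (sq_nonneg (u - 1)))]

/-- Integrate `sqrt_ge_quadratic` at `t = ‖x‖²/k`: the linear term has mean zero, and the quadratic
one is a variance that is additive over coordinates. -/
theorem one_sub_le_meanNormRatio {k : ℕ} (hk : 0 < k) :
    1 - Var[fun x ↦ x ^ 2; gaussianReal 0 1] / (2 * k) ≤ meanNormRatio k := by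
  have hk' : (0 : ℝ) < k := by exact_mod_cast hk
  set μ := stdGaussian (EuclideanSpace ℝ (Fin k))
  have hvar := variance_norm_sq_stdGaussian k
  rw [variance_eq_integral (by fun_prop), integral_norm_sq_stdGaussian] at hvar
  have hI2 : Integrable (fun x ↦ (‖x‖ ^ 2 - (k : ℝ)) ^ 2) μ :=
    ((memLp_norm_sq_stdGaussian k).sub (memLp_const _)).integrable_sq
  have hI1 : Integrable (fun x ↦ ‖x‖ ^ 2 - (k : ℝ)) μ :=
    (integrable_norm_sq_stdGaussian k).sub (integrable_const _)
  have h1 : ∫ x, (‖x‖ ^ 2 - (k : ℝ)) ∂μ = 0 := by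
    rw [integral_sub (integrable_norm_sq_stdGaussian k) (integrable_const _),
      integral_norm_sq_stdGaussian]
    simp
  have hle : ∫ x, (1 + (1 / (2 * k)) * (‖x‖ ^ 2 - (k : ℝ)) -
      (1 / (2 * k ^ 2)) * (‖x‖ ^ 2 - (k : ℝ)) ^ 2) ∂μ ≤ ∫ x, ‖x‖ / √k ∂μ := by
    refine integral_mono (((integrable_const _).add (hI1.const_mul _)).sub (hI2.const_mul _))
      ((integrable_norm_stdGaussian k).div_const _) fun x ↦ ?_
    have := sqrt_ge_quadratic (t := ‖x‖ ^ 2 / k) (by positivity)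
    rw [Real.sqrt_div (by positivity), Real.sqrt_sq (norm_nonneg _)] at this
    refine le_trans (le_of_eq ?_) this
    field_simp
  have hI3 : Integrable (fun x ↦ 1 + (1 / (2 * k)) * (‖x‖ ^ 2 - (k : ℝ))) μ :=
    (integrable_const _).add (hI1.const_mul _)
  rw [integral_sub hI3 (hI2.const_mul _),
    integral_add (integrable_const _) (hI1.const_mul _), integral_const_mul, integral_const_mul,
    h1, hvar, integral_div] at hle
  rw [meanNormRatio]
  refine le_trans (le_of_eq ?_) hle
  simp
  field_simp

theorem tendsto_meanNormRatio : Filter.Tendsto meanNormRatio Filter.atTop (nhds 1) := by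
  have h : Filter.Tendsto (fun k : ℕ ↦ 1 - Var[fun x ↦ x ^ 2; gaussianReal 0 1] / 2 / (k : ℝ))
      Filter.atTop (nhds (1 - 0)) :=
    tendsto_const_nhds.sub (tendsto_const_div_atTop_nhds_zero_nat _)
  rw [sub_zero] at h
  refine tendsto_of_tendsto_of_tendsto_of_le_of_le' h tendsto_const_nhds ?_
    (Filter.Eventually.of_forall meanNormRatio_le_one)
  filter_upwards [Filter.eventually_gt_atTop 0] with k hk
  rw [div_div]
  exact one_sub_le_meanNormRatio hk

theorem integral_norm_isoGaussian {k : ℕ} (hk : 0 < k) {s : ℝ} (hs : 0 ≤ s) :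
    ∫ x, ‖x‖ ∂(isoGaussian k (s / k)) = √s * meanNormRatio k := by
  rw [isoGaussian_eq_map_smul_stdGaussian k (by positivity), integral_map (by fun_prop)
    (by fun_prop)]
  simp_rw [norm_smul, Real.norm_eq_abs, abs_of_nonneg (Real.sqrt_nonneg _)]
  rw [integral_const_mul, Real.sqrt_div hs, meanNormRatio]
  ring

theorem integral_norm_sq_isoGaussian {k : ℕ} (hk : 0 < k) {s : ℝ} (hs : 0 ≤ s) :
    ∫ x, ‖x‖ ^ 2 ∂(isoGaussian k (s / k)) = s := by
  rw [isoGaussian_eq_map_smul_stdGaussian k (by positivity), integral_map (by fun_prop)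
    (by fun_prop)]
  simp_rw [norm_smul, mul_pow, Real.norm_eq_abs, sq_abs]
  rw [Real.sq_sqrt (by positivity), integral_const_mul, integral_norm_sq_stdGaussian]
  field_simp

theorem integral_norm_add_const_sq_isoGaussian {k : ℕ} (hk : 0 < k) {s : ℝ} (hs : 0 ≤ s) (b : ℝ) :
    ∫ x, (‖x‖ + b) ^ 2 ∂(isoGaussian k (s / k)) = s + 2 * b * (√s * meanNormRatio k) + b ^ 2 := by
  have h1 : Integrable (fun x ↦ ‖x‖) (isoGaussian k (s / k)) := by
    unfold isoGaussian
    exact IsGaussian.integrable_id.norm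
  have h2 : Integrable (fun x ↦ ‖x‖ ^ 2) (isoGaussian k (s / k)) := by
    unfold isoGaussian
    exact ((IsGaussian.memLp_id _ 2 (by simp)).norm).integrable_sq
  simp_rw [add_sq]
  have hr (x : EuclideanSpace ℝ (Fin k)) : 2 * ‖x‖ * b = 2 * b * ‖x‖ := by ring
  simp_rw [hr]
  have h3 : Integrable (fun x ↦ ‖x‖ ^ 2 + 2 * b * ‖x‖) (isoGaussian k (s / k)) :=
    h2.add (h1.const_mul _)
  rw [integral_add h3 (integrable_const _),
    integral_add h2 (h1.const_mul _), integral_const_mul, integral_norm_isoGaussian hk hs,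
    integral_norm_sq_isoGaussian hk hs]
  simp

/-! ### The limiting one-dimensional problem -/

/-- The mean squared error of the shrinkage factor `a` in the absence of perturbations. -/
noncomputable def shrinkageVariance (σc τ a : ℝ) : ℝ := (a - 1) ^ 2 * σc ^ 2 + a ^ 2 * τ ^ 2

/-- The limit of the robust risk of the shrinkage factor `a` as the dimension grows. -/
noncomputable def limitRisk (σc τ ε a : ℝ) : ℝ := (√(shrinkageVariance σc τ a) + ε * |a|) ^ 2

theorem shrinkageVariance_nonneg (σc τ a : ℝ) : 0 ≤ shrinkageVariance σc τ a := by
  unfold shrinkageVariance; positivity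

theorem limitRisk_zero {σc : ℝ} (hσc : 0 ≤ σc) (τ ε : ℝ) : limitRisk σc τ ε 0 = σc ^ 2 := by
  simp [limitRisk, shrinkageVariance, Real.sqrt_sq hσc]

theorem shrinkage_eq (σc σz ε r : ℝ) (h : ε ^ 2 < σc ^ 2) (hr : 0 ≤ r) :
    shrinkage σc σz ε r = (σc ^ 2 - ε * (σc * (σz * √r)) /
      √(σc ^ 2 + (σz * √r) ^ 2 - ε ^ 2)) / (σc ^ 2 + (σz * √r) ^ 2) := by
  rw [shrinkage, if_pos h, mul_pow, Real.sq_sqrt hr]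
  ring_nf

/-- The line `b ↦ M - εb` is tangent to `√V` at `α`, with `V(b) = (M - εb)² + B²(b - α)²`. Hence
`√V(b) + ε|b| ≥ M`, with equality at `α` because `α ≥ 0` and `M - εα ≥ 0`. The square left over
gives the growth, as `B² ≥ σc² - ε²`. -/
theorem growth_of_lt {σc τ ε : ℝ} (hτ : 0 ≤ τ) (hε : 0 ≤ ε) (h : ε < σc) (a : ℝ) :
    (σc ^ 2 - ε ^ 2) * (a - (σc ^ 2 - ε * (σc * τ) / √(σc ^ 2 + τ ^ 2 - ε ^ 2)) /
      (σc ^ 2 + τ ^ 2)) ^ 2 ≤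
    2 * (limitRisk σc τ ε a - limitRisk σc τ ε
      ((σc ^ 2 - ε * (σc * τ) / √(σc ^ 2 + τ ^ 2 - ε ^ 2)) / (σc ^ 2 + τ ^ 2))) := by
  have hc : 0 < σc := hε.trans_lt h
  have hce : ε ^ 2 < σc ^ 2 := by gcongr
  set A := σc ^ 2 + τ ^ 2 with hA
  have hA0 : 0 < A := by positivity
  have hAε : 0 < A - ε ^ 2 := by nlinarith [sq_nonneg τ]
  set B := √(A - ε ^ 2) with hB
  have hB0 : 0 < B := Real.sqrt_pos.2 hAε
  have hB2 : B ^ 2 = A - ε ^ 2 := Real.sq_sqrt hAε.le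
  set q := σc * τ with hq
  have hq0 : 0 ≤ q := by positivity
  set α := (σc ^ 2 - ε * q / B) / A with hα
  set M := (ε * σc ^ 2 + q * B) / A with hM
  have hM0 : 0 ≤ M := by positivity
  have hαA : A * α = σc ^ 2 - ε * q / B := by rw [hα]; field_simp
  have hαB : B * (σc ^ 2 - A * α) = ε * q := by rw [hαA]; field_simp; ring
  have hMA : A * M = ε * σc ^ 2 + q * B := by rw [hM]; field_simp
  have key (b : ℝ) : shrinkageVariance σc τ b = (M - ε * b) ^ 2 + B ^ 2 * (b - α) ^ 2 := by
    have h1 : A ^ 2 * shrinkageVariance σc τ b =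
        A * ((σc ^ 2 - A * b) ^ 2 + q ^ 2) := by
      rw [shrinkageVariance, hA, hq]; ring
    have h2 : A ^ 2 * ((M - ε * b) ^ 2 + B ^ 2 * (b - α) ^ 2) =
        (ε * σc ^ 2 + q * B - ε * (A * b)) ^ 2 + (B * (σc ^ 2 - A * b) - ε * q) ^ 2 := by
      rw [← hMA, ← hαB]; ring
    -- Brahmagupta's identity `(εX + Bq)² + (BX - εq)² = (ε² + B²)(X² + q²)` with `X = σc² - Ab`.
    have h3 : (ε * σc ^ 2 + q * B - ε * (A * b)) ^ 2 + (B * (σc ^ 2 - A * b) - ε * q) ^ 2 =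
        (ε ^ 2 + B ^ 2) * ((σc ^ 2 - A * b) ^ 2 + q ^ 2) := by ring
    have h4 : ε ^ 2 + B ^ 2 = A := by rw [hB2]; ring
    rw [h4] at h3
    exact mul_left_cancel₀ (pow_ne_zero 2 hA0.ne') (by rw [h1, h2, h3])
  have hα0 : 0 ≤ α := by
    refine div_nonneg (sub_nonneg.2 ?_) hA0.le
    rw [div_le_iff₀ hB0]
    refine (sq_le_sq₀ (by positivity) (by positivity)).1 ?_
    rw [mul_pow, mul_pow (σc ^ 2), hB2, hq, hA]
    -- The difference of the two sides is `σc²(σc² - ε²)(σc² + τ²)`.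
    nlinarith [mul_nonneg (sq_nonneg σc) (mul_nonneg (sub_nonneg.2 hce.le)
      (add_nonneg (sq_nonneg σc) (sq_nonneg τ)))]
  have hLα : 0 ≤ M - ε * α := by
    have : A * (M - ε * α) = ε * (ε * q / B) + q * B := by
      rw [mul_sub, hMA, mul_left_comm, hαA]; ring
    have h5 : 0 ≤ A * (M - ε * α) := by rw [this]; positivity
    exact nonneg_of_mul_nonneg_right h5 hA0
  have hFα : limitRisk σc τ ε α = M ^ 2 := by
    rw [limitRisk, key, abs_of_nonneg hα0, sub_self]
    rw [zero_pow two_ne_zero, mul_zero, add_zero, Real.sqrt_sq hLα]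
    ring
  rw [hFα, limitRisk]
  set s := √(shrinkageVariance σc τ a) with hs
  have hs0 : 0 ≤ s := Real.sqrt_nonneg _
  have hs2 : s ^ 2 = (M - ε * a) ^ 2 + B ^ 2 * (a - α) ^ 2 := by
    rw [hs, Real.sq_sqrt (shrinkageVariance_nonneg _ _ _), key]
  have hsL : M - ε * a ≤ s := by
    refine le_of_abs_le (abs_le_of_sq_le_sq ?_ hs0)
    rw [hs2]; nlinarith [mul_nonneg (sq_nonneg B) (sq_nonneg (a - α))]
  have hab : ε * a ≤ ε * |a| := mul_le_mul_of_nonneg_left (le_abs_self a) hε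
  have hab0 : 0 ≤ ε * |a| := by positivity
  set m := s + ε * |a| with hm
  have hmM : M ≤ m := by linarith
  calc (σc ^ 2 - ε ^ 2) * (a - α) ^ 2 ≤ B ^ 2 * (a - α) ^ 2 := by
        refine mul_le_mul_of_nonneg_right ?_ (sq_nonneg _)
        rw [hB2, hA]; nlinarith [sq_nonneg τ]
    _ = (s - (M - ε * a)) * (s + (M - ε * a)) := by linear_combination -hs2
    _ ≤ (m - M) * (2 * m) := by
        rcases le_or_gt 0 (s + (M - ε * a)) with h0 | h0
        · exact mul_le_mul (by linarith) (by linarith) h0 (by linarith)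
        · exact (mul_nonpos_of_nonneg_of_nonpos (by linarith) h0.le).trans
            (mul_nonneg (by linarith) (by linarith))
    _ ≤ 2 * (m ^ 2 - M ^ 2) := by nlinarith

theorem sub_mul_abs_le_sqrt_shrinkageVariance {σc : ℝ} (hσc : 0 ≤ σc) (τ a : ℝ) :
    σc - σc * |a| ≤ √(shrinkageVariance σc τ a) := by
  refine (?_ : _ ≤ |σc * (1 - a)|).trans (Real.abs_le_sqrt ?_)
  · rw [abs_mul, abs_of_nonneg hσc, ← mul_one_sub]
    refine mul_le_mul_of_nonneg_left ?_ hσc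
    have := abs_sub_abs_le_abs_sub 1 a
    rwa [abs_one] at this
  · rw [shrinkageVariance]
    nlinarith [sq_nonneg (a * τ)]

theorem growth_of_gt {σc τ ε : ℝ} (hσc : 0 ≤ σc) (h : σc ≤ ε) (a : ℝ) :
    (ε - σc) ^ 2 * a ^ 2 ≤ limitRisk σc τ ε a - limitRisk σc τ ε 0 := by
  rw [limitRisk_zero hσc, limitRisk]
  have h1 := sub_mul_abs_le_sqrt_shrinkageVariance hσc τ a
  have h2 : 0 ≤ (ε - σc) * |a| := mul_nonneg (by linarith) (abs_nonneg a)
  have h3 : (σc + (ε - σc) * |a|) ^ 2 ≤ (√(shrinkageVariance σc τ a) + ε * |a|) ^ 2 :=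
    pow_le_pow_left₀ (by positivity) (by linarith) 2
  rw [← sq_abs a]
  nlinarith [mul_nonneg hσc h2]

/-- At `ε = σc` the bound of `growth_of_gt` is void. Expanding `L` and using `√V ≥ σc - σc|a|`, the
terms `σc²a²` cancel and only `τ²a²` plus `2σc²(|a| - a) ≥ 0` is left over `σc²`. This growth
degenerates as `d/n → 0`, whence the condition `n ≤ Kd`. -/
theorem growth_of_eq {σc : ℝ} (hσc : 0 ≤ σc) (τ a : ℝ) :
    τ ^ 2 * a ^ 2 ≤ limitRisk σc τ σc a - limitRisk σc τ σc 0 := by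
  rw [limitRisk_zero hσc, limitRisk]
  have h1 := sub_mul_abs_le_sqrt_shrinkageVariance hσc τ a
  have h2 := Real.sq_sqrt (shrinkageVariance_nonneg σc τ a)
  set s := √(shrinkageVariance σc τ a)
  rw [shrinkageVariance] at h2
  have h3 : 0 ≤ σc * |a| := by positivity
  nlinarith [mul_le_mul_of_nonneg_left h1 h3, le_abs_self a, sq_abs a,
    mul_le_mul_of_nonneg_left (le_abs_self a) (sq_nonneg σc)]

/-- The shrinkage factor minimizes the limiting risk. -/
theorem limitRisk_shrinkage_le {σc σz ε r : ℝ} (hσc : 0 ≤ σc) (hσz : 0 ≤ σz) (hε : 0 ≤ ε)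
    (hr : 0 ≤ r) (a : ℝ) :
    limitRisk σc (σz * √r) ε (shrinkage σc σz ε r) ≤ limitRisk σc (σz * √r) ε a := by
  rcases lt_or_ge ε σc with h | h
  · have hce : ε ^ 2 < σc ^ 2 := by gcongr
    rw [shrinkage_eq σc σz ε r hce hr]
    have := growth_of_lt (mul_nonneg hσz (Real.sqrt_nonneg r)) hε h a
    have h2 := mul_nonneg (sub_nonneg.2 hce.le) (sq_nonneg (a - (σc ^ 2 - ε * (σc * (σz * √r)) /
      √(σc ^ 2 + (σz * √r) ^ 2 - ε ^ 2)) / (σc ^ 2 + (σz * √r) ^ 2)))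
    linarith
  · have hce : ¬ ε ^ 2 < σc ^ 2 := not_lt.2 (by gcongr)
    rw [shrinkage, if_neg hce]
    have := growth_of_gt (τ := σz * √r) hσc h a
    nlinarith [mul_nonneg (sq_nonneg (ε - σc)) (sq_nonneg a)]

/-- The limiting risk grows quadratically around its minimizer, uniformly in the aspect ratio. -/
theorem exists_quadratic_growth {σc σz ε : ℝ} (hσc : 0 ≤ σc) (hσz : 0 < σz) (hε : 0 ≤ ε) (K : ℝ) :
    ∃ C : ℝ, 0 < C ∧ ∀ r : ℝ, 0 ≤ r → (ε ≠ σc ∨ 1 ≤ K * r) → ∀ a : ℝ,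
      C * (a - shrinkage σc σz ε r) ^ 2 ≤ limitRisk σc (σz * √r) ε a -
        limitRisk σc (σz * √r) ε (shrinkage σc σz ε r) := by
  rcases lt_trichotomy ε σc with h | h | h
  · have hce : ε ^ 2 < σc ^ 2 := by gcongr
    refine ⟨(σc ^ 2 - ε ^ 2) / 2, by linarith, fun r hr _ a ↦ ?_⟩
    rw [shrinkage_eq σc σz ε r hce hr]
    have := growth_of_lt (mul_nonneg hσz.le (Real.sqrt_nonneg r)) hε h a
    linarith
  · subst h
    -- Since `1 ≤ Kr`, `τ² = σz² r` is at least this constant; the maximum with 1 keeps the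
    -- denominator positive for every `K`.
    refine ⟨σz ^ 2 / max K 1, by positivity, fun r hr hK a ↦ ?_⟩
    rw [shrinkage, if_neg (lt_irrefl _), sub_zero]
    refine le_trans (mul_le_mul_of_nonneg_right ?_ (sq_nonneg a)) (growth_of_eq hσc _ a)
    rw [mul_pow, Real.sq_sqrt hr, div_le_iff₀ (by positivity)]
    have h1 : 1 ≤ K * r := hK.resolve_left (by simp)
    have h2 : K * r ≤ max K 1 * r := mul_le_mul_of_nonneg_right (le_max_left _ _) hr
    nlinarith [sq_nonneg σz]
  · have hce : ¬ ε ^ 2 < σc ^ 2 := not_lt.2 (by gcongr)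
    refine ⟨(ε - σc) ^ 2, pow_pos (sub_pos.2 h) 2, fun r hr _ a ↦ ?_⟩
    rw [shrinkage, if_neg hce, sub_zero]
    exact growth_of_gt hσc h.le a

/-! ### The worst-case error of linear estimators -/

theorem linEst_apply {n : ℕ} (H : Matrix (Fin n) (Fin n) ℝ) (y : EuclideanSpace ℝ (Fin n)) :
    linEst H y = Matrix.toEuclideanLin H y := rfl

theorem le_worstCaseError {n : ℕ} {ε : ℝ} (hε : 0 ≤ ε) (H : Matrix (Fin n) (Fin n) ℝ)
    (x z : EuclideanSpace ℝ (Fin n)) {e : EuclideanSpace ℝ (Fin n)} (he : ‖e‖ ≤ ε) :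
    ‖linEst H (x + z + e) - x‖ ^ 2 ≤ worstCaseError ε (linEst H) x z :=
  (worstCaseError_isGreatest hε H x z).2 ⟨e, by simpa using he, rfl⟩

theorem exists_worstCaseError_eq {n : ℕ} {ε : ℝ} (hε : 0 ≤ ε) (H : Matrix (Fin n) (Fin n) ℝ)
    (x z : EuclideanSpace ℝ (Fin n)) :
    ∃ e, ‖e‖ ≤ ε ∧ ‖linEst H (x + z + e) - x‖ ^ 2 = worstCaseError ε (linEst H) x z := by
  obtain ⟨e, he, h⟩ := (worstCaseError_isGreatest hε H x z).1
  exact ⟨e, by simpa using he, h⟩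

theorem worstCaseError_le {n : ℕ} {ε : ℝ} (hε : 0 ≤ ε) (H : Matrix (Fin n) (Fin n) ℝ)
    (x z : EuclideanSpace ℝ (Fin n)) {B : ℝ}
    (h : ∀ e, ‖e‖ ≤ ε → ‖linEst H (x + z + e) - x‖ ^ 2 ≤ B) :
    worstCaseError ε (linEst H) x z ≤ B := by
  obtain ⟨e, he, heq⟩ := exists_worstCaseError_eq hε H x z
  exact heq ▸ h e he

/-- A vector of norm at most `ε` aligned with `v`. -/
theorem exists_norm_add_smul_eq {d : ℕ} (hd : 0 < d) {ε : ℝ} (hε : 0 ≤ ε) (a : ℝ)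
    (v : EuclideanSpace ℝ (Fin d)) : ∃ f, ‖f‖ ≤ ε ∧ ‖v + a • f‖ = ‖v‖ + ε * |a| := by
  obtain ⟨u, hu, huv⟩ : ∃ u : EuclideanSpace ℝ (Fin d), ‖u‖ = 1 ∧ v = ‖v‖ • u := by
    rcases eq_or_ne v 0 with rfl | hv
    · exact ⟨EuclideanSpace.single ⟨0, hd⟩ 1, by simp, by simp⟩
    · exact ⟨‖v‖⁻¹ • v, by simp [norm_smul, hv], by simp [smul_smul, hv]⟩
  obtain ⟨t, ht, hta⟩ : ∃ t : ℝ, |t| ≤ ε ∧ a * t = ε * |a| := by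
    rcases le_total 0 a with h | h
    · exact ⟨ε, by simp [abs_of_nonneg hε], by rw [abs_of_nonneg h, mul_comm]⟩
    · exact ⟨-ε, by simp [abs_of_nonneg hε], by rw [abs_of_nonpos h]; ring⟩
  refine ⟨t • u, by simpa [norm_smul, hu] using ht, ?_⟩
  have : v + a • t • u = (‖v‖ + ε * |a|) • u := by
    rw [add_smul, ← huv, smul_smul, hta]
  rw [this, norm_smul, hu, mul_one, Real.norm_eq_abs, abs_of_nonneg (by positivity)]

/-- The residual lies in the range of `U`, so its norm can be computed in `ℝ^d`, where `Uᵀe` fills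
the `ε`-ball. -/
theorem worstCaseError_smul_projection {n d : ℕ} (hd : 0 < d) {U : Matrix (Fin n) (Fin d) ℝ}
    (hU : U.transpose * U = 1) {ε : ℝ} (hε : 0 ≤ ε) (a : ℝ) (c : EuclideanSpace ℝ (Fin d))
    (z : EuclideanSpace ℝ (Fin n)) :
    worstCaseError ε (linEst (a • (U * U.transpose))) (Matrix.toEuclideanLin U c) z =
      (‖(a - 1) • c + a • Matrix.toEuclideanLin U.transpose z‖ + ε * |a|) ^ 2 := by
  have key (e : EuclideanSpace ℝ (Fin n)) :
      ‖linEst (a • (U * U.transpose)) (Matrix.toEuclideanLin U c + z + e) -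
        Matrix.toEuclideanLin U c‖ =
      ‖(a - 1) • c + a • Matrix.toEuclideanLin U.transpose z +
        a • Matrix.toEuclideanLin U.transpose e‖ := by
    rw [← norm_toEuclideanLin_of_transpose_mul_self hU, linEst_apply, map_smul,
      LinearMap.smul_apply, toEuclideanLin_mul_apply]
    simp only [map_add, transpose_toEuclideanLin_apply_self hU, map_smul]
    congr 1
    module
  refine le_antisymm (worstCaseError_le hε _ _ _ fun e he ↦ ?_) ?_
  · rw [key]
    refine pow_le_pow_left₀ (norm_nonneg _) ((norm_add_le _ _).trans ?_) 2
    rw [norm_smul a, Real.norm_eq_abs, mul_comm ε]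
    gcongr
    exact (norm_toEuclideanLin_transpose_le hU e).trans he
  · obtain ⟨f, hf, hfv⟩ := exists_norm_add_smul_eq hd hε a
      ((a - 1) • c + a • Matrix.toEuclideanLin U.transpose z)
    have := le_worstCaseError hε (a • (U * U.transpose)) (Matrix.toEuclideanLin U c) z
      (e := Matrix.toEuclideanLin U f) (by rwa [norm_toEuclideanLin_of_transpose_mul_self hU])
    rwa [key, transpose_toEuclideanLin_apply_self hU, hfv] at this

theorem linEst_combo {n : ℕ} (s t : ℝ) (hst : s + t = 1) (G H : Matrix (Fin n) (Fin n) ℝ)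
    (x y : EuclideanSpace ℝ (Fin n)) :
    linEst (s • G + t • H) y - x = s • (linEst G y - x) + t • (linEst H y - x) := by
  rw [linEst_apply, linEst_apply, linEst_apply, map_add, map_smul, map_smul, LinearMap.add_apply,
    LinearMap.smul_apply, LinearMap.smul_apply]
  nth_rewrite 1 [← one_smul ℝ x]
  rw [← hst]
  module

theorem norm_sq_combo {E : Type*} [NormedAddCommGroup E] [InnerProductSpace ℝ E] (s t : ℝ)
    (hst : s + t = 1) (u v : E) :
    ‖s • u + t • v‖ ^ 2 = s * ‖u‖ ^ 2 + t * ‖v‖ ^ 2 - s * t * ‖u - v‖ ^ 2 := by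
  obtain rfl : t = 1 - s := by linarith
  rw [norm_add_sq_real, norm_sub_sq_real, norm_smul, norm_smul, real_inner_smul_left,
    real_inner_smul_right, mul_pow, mul_pow, Real.norm_eq_abs, Real.norm_eq_abs, sq_abs, sq_abs]
  ring

/-- Take the perturbation that is worst for the combination and compare at that point. The defect
term is kept because strict convexity rests on it. -/
theorem worstCaseError_combo_le {n : ℕ} {ε : ℝ} (hε : 0 ≤ ε) {s t : ℝ} (hs : 0 ≤ s) (ht : 0 ≤ t)
    (hst : s + t = 1) (G H : Matrix (Fin n) (Fin n) ℝ) (x z : EuclideanSpace ℝ (Fin n)) :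
    ∃ e, ‖e‖ ≤ ε ∧ worstCaseError ε (linEst (s • G + t • H)) x z ≤
      s * worstCaseError ε (linEst G) x z + t * worstCaseError ε (linEst H) x z -
        s * t * ‖linEst (G - H) (x + z + e)‖ ^ 2 := by
  obtain ⟨e, he, heq⟩ := exists_worstCaseError_eq hε (s • G + t • H) x z
  refine ⟨e, he, ?_⟩
  have hdiff : linEst (G - H) (x + z + e) =
      (linEst G (x + z + e) - x) - (linEst H (x + z + e) - x) := by
    rw [sub_sub_sub_cancel_right, linEst_apply, linEst_apply, linEst_apply, map_sub,
      LinearMap.sub_apply]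
  rw [← heq, linEst_combo s t hst, norm_sq_combo s t hst, hdiff]
  gcongr
  · exact le_worstCaseError hε G x z he
  · exact le_worstCaseError hε H x z he

theorem convexOn_robustRisk {n d : ℕ} (U : Matrix (Fin n) (Fin d) ℝ) (σc σz : ℝ) {ε : ℝ}
    (hε : 0 ≤ ε) : ConvexOn ℝ Set.univ
      (fun H : Matrix (Fin n) (Fin n) ℝ ↦ robustRisk U σc σz ε (linEst H)) := by
  refine ⟨convex_univ, fun G _ H _ s t hs ht hst ↦ ?_⟩
  simp only [robustRisk, smul_eq_mul]
  have hG := worstCaseError_integrable U σc σz hε G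
  have hH := worstCaseError_integrable U σc σz hε H
  rw [← integral_const_mul, ← integral_const_mul, ← integral_add (hG.const_mul s) (hH.const_mul t)]
  refine integral_mono (worstCaseError_integrable U σc σz hε _)
    ((hG.const_mul s).add (hH.const_mul t)) fun p ↦ ?_
  obtain ⟨e, -, he⟩ := worstCaseError_combo_le hε hs ht hst G H (Matrix.toEuclideanLin U p.1) p.2
  exact he.trans (sub_le_self _ (by positivity))

/-! ### Reduction to the range of `U` and symmetrization -/

/-- Perturbations `e = Uf` in the range of `U` suffice. The errors at `z` and `Qz` have equal
expectation, the mean of `z` and `Qz` is `UUᵀz`, and `Uᵀ` is a contraction. -/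
theorem robustRisk_compression_le {n d : ℕ} (hd : 0 < d) {U : Matrix (Fin n) (Fin d) ℝ}
    (hU : U.transpose * U = 1) (σc σz : ℝ) {ε : ℝ} (hε : 0 ≤ ε) (H : Matrix (Fin n) (Fin n) ℝ) :
    robustRisk (1 : Matrix (Fin d) (Fin d) ℝ) σc (σz * √((d : ℝ) / n)) ε
      (linEst (U.transpose * H * U)) ≤ robustRisk U σc σz ε (linEst H) := by
  set Q : Matrix (Fin n) (Fin n) ℝ := (2 : ℝ) • (U * U.transpose) - 1 with hQdef
  have hQ : Q * Q.transpose = 1 := by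
    have h1 : U * U.transpose * (U * U.transpose) = U * U.transpose := by
      rw [Matrix.mul_assoc, ← Matrix.mul_assoc U.transpose, hU, Matrix.one_mul]
    have h2 : Q.transpose = Q := by simp [hQdef, Matrix.transpose_mul]
    rw [h2, hQdef, Matrix.sub_mul, Matrix.mul_sub, Matrix.smul_mul, Matrix.mul_smul, h1]
    simp only [Matrix.mul_one, Matrix.one_mul]
    module
  have hint := worstCaseError_integrable U σc σz hε H
  have hmap := modelLaw_map_orthogonal (n := n) (d := d) (V := 1) (by simp) hQ σc σz
  have hmQ : Measurable (Prod.map (Matrix.toEuclideanLin (1 : Matrix (Fin d) (Fin d) ℝ))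
      (Matrix.toEuclideanLin Q)) :=
    (continuous_toEuclideanLin _).measurable.prodMap (continuous_toEuclideanLin _).measurable
  have hmU : Measurable (Prod.map (id : EuclideanSpace ℝ (Fin d) → EuclideanSpace ℝ (Fin d))
      (Matrix.toEuclideanLin U.transpose)) :=
    measurable_id.prodMap (continuous_toEuclideanLin _).measurable
  have hint' : Integrable (fun p : EuclideanSpace ℝ (Fin d) × EuclideanSpace ℝ (Fin n) ↦
      worstCaseError ε (linEst H) (Matrix.toEuclideanLin U p.1) (Matrix.toEuclideanLin Q p.2))
      (modelLaw n d σc σz) := by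
    have h := hint
    rw [← hmap, integrable_map_measure (by rw [hmap]; exact hint.aestronglyMeasurable)
      hmQ.aemeasurable] at h
    simpa [Function.comp_def] using h
  have heq : ∫ p, worstCaseError ε (linEst H) (Matrix.toEuclideanLin U p.1)
      (Matrix.toEuclideanLin Q p.2) ∂(modelLaw n d σc σz) = robustRisk U σc σz ε (linEst H) := by
    rw [robustRisk]
    conv_rhs => rw [← hmap, integral_map hmQ.aemeasurable
      (by rw [hmap]; exact hint.aestronglyMeasurable)]
    simp
  have hintG := worstCaseError_integrable (1 : Matrix (Fin d) (Fin d) ℝ) σc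
    (σz * √((d : ℝ) / n)) hε (U.transpose * H * U)
  have hmap' := modelLaw_map_transpose hd hU σc σz
  have hsplit : robustRisk U σc σz ε (linEst H) =
      ∫ p, ((1 / 2 : ℝ) * worstCaseError ε (linEst H) (Matrix.toEuclideanLin U p.1) p.2 +
        (1 / 2 : ℝ) * worstCaseError ε (linEst H) (Matrix.toEuclideanLin U p.1)
          (Matrix.toEuclideanLin Q p.2)) ∂(modelLaw n d σc σz) := by
    rw [integral_add (hint.const_mul _) (hint'.const_mul _), integral_const_mul,
      integral_const_mul, heq, ← robustRisk]
    ring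
  rw [hsplit, robustRisk]
  rw [← hmap'] at hintG ⊢
  rw [integral_map hmU.aemeasurable hintG.aestronglyMeasurable]
  refine integral_mono ((integrable_map_measure hintG.aestronglyMeasurable hmU.aemeasurable).1
    hintG) ((hint.const_mul _).add (hint'.const_mul _)) fun p ↦ ?_
  obtain ⟨c, z⟩ := p
  simp only [Prod.map_apply, id_eq, toEuclideanLin_one_apply]
  refine worstCaseError_le hε _ _ _ fun f hf ↦ ?_
  set e := Matrix.toEuclideanLin U f with he
  have hen : ‖e‖ ≤ ε := by rwa [he, norm_toEuclideanLin_of_transpose_mul_self hU]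
  set x := Matrix.toEuclideanLin U c with hx
  have hlin : linEst (U.transpose * H * U) (c + Matrix.toEuclideanLin U.transpose z + f) - c =
      Matrix.toEuclideanLin U.transpose ((1 / 2 : ℝ) • (linEst H (x + z + e) - x) +
        (1 / 2 : ℝ) • (linEst H (x + Matrix.toEuclideanLin Q z + e) - x)) := by
    have hQz : Matrix.toEuclideanLin Q z = (2 : ℝ) • Matrix.toEuclideanLin U
        (Matrix.toEuclideanLin U.transpose z) - z := by
      rw [hQdef, map_sub, map_smul, LinearMap.sub_apply, LinearMap.smul_apply,
        toEuclideanLin_mul_apply, toEuclideanLin_one_apply]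
    have hc : Matrix.toEuclideanLin U.transpose x = c := transpose_toEuclideanLin_apply_self hU c
    simp only [linEst_apply, toEuclideanLin_mul_apply, hQz, map_add, map_sub, map_smul, hc,
      ← hx, ← he]
    module
  rw [hlin]
  refine (pow_le_pow_left₀ (norm_nonneg _) (norm_toEuclideanLin_transpose_le hU _) 2).trans ?_
  rw [norm_sq_combo _ _ (by norm_num)]
  refine (sub_le_self _ (by positivity)).trans ?_
  gcongr
  · exact le_worstCaseError hε H x z hen
  · exact le_worstCaseError hε H x _ hen

theorem worstCaseError_conj {d : ℕ} {Q : Matrix (Fin d) (Fin d) ℝ} (hQ : Q.transpose * Q = 1)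
    {ε : ℝ} (hε : 0 ≤ ε) (G : Matrix (Fin d) (Fin d) ℝ) (x z : EuclideanSpace ℝ (Fin d)) :
    worstCaseError ε (linEst (Q.transpose * G * Q)) x z ≤
      worstCaseError ε (linEst G) (Matrix.toEuclideanLin Q x) (Matrix.toEuclideanLin Q z) := by
  refine worstCaseError_le hε _ _ _ fun e he ↦ ?_
  have := le_worstCaseError hε G (Matrix.toEuclideanLin Q x) (Matrix.toEuclideanLin Q z)
    (e := Matrix.toEuclideanLin Q e) (by rwa [norm_toEuclideanLin_of_transpose_mul_self hQ])
  refine le_trans (pow_le_pow_left₀ (norm_nonneg _) ?_ 2) this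
  refine le_trans (le_of_eq ?_) (norm_toEuclideanLin_transpose_le hQ _)
  simp only [map_sub, map_add, linEst_apply, toEuclideanLin_mul_apply,
    transpose_toEuclideanLin_apply_self hQ]

theorem robustRisk_conj_le {d : ℕ} {Q : Matrix (Fin d) (Fin d) ℝ} (hQ : Q.transpose * Q = 1)
    (σc σz : ℝ) {ε : ℝ} (hε : 0 ≤ ε) (G : Matrix (Fin d) (Fin d) ℝ) :
    robustRisk (1 : Matrix (Fin d) (Fin d) ℝ) σc σz ε (linEst (Q.transpose * G * Q)) ≤
      robustRisk (1 : Matrix (Fin d) (Fin d) ℝ) σc σz ε (linEst G) := by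
  have hmap := modelLaw_map_orthogonal (mul_eq_one_comm.1 hQ) (mul_eq_one_comm.1 hQ) σc σz
  have hm : Measurable (Prod.map (Matrix.toEuclideanLin Q) (Matrix.toEuclideanLin Q)) :=
    (continuous_toEuclideanLin _).measurable.prodMap (continuous_toEuclideanLin _).measurable
  have hint := worstCaseError_integrable (1 : Matrix (Fin d) (Fin d) ℝ) σc σz hε G
  rw [robustRisk, robustRisk]
  conv_rhs => rw [← hmap]
  rw [← hmap] at hint
  rw [integral_map hm.aemeasurable hint.aestronglyMeasurable]
  refine integral_mono (worstCaseError_integrable _ σc σz hε _)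
    ((integrable_map_measure hint.aestronglyMeasurable hm.aemeasurable).1 hint) fun p ↦ ?_
  simp only [Prod.map_fst, Prod.map_snd, toEuclideanLin_one_apply]
  exact worstCaseError_conj hQ hε G p.1 p.2

/-- The signed permutation matrix mapping the basis vector `e_i` to `s_i e_{π i}`. -/
def signedPerm {d : ℕ} (s : Fin d → ℤˣ) (π : Equiv.Perm (Fin d)) : Matrix (Fin d) (Fin d) ℝ :=
  Matrix.of fun l i ↦ if l = π i then ((s i : ℤ) : ℝ) else 0

theorem signedPerm_conj_apply {d : ℕ} (s : Fin d → ℤˣ) (π : Equiv.Perm (Fin d))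
    (G : Matrix (Fin d) (Fin d) ℝ) (i j : Fin d) :
    ((signedPerm s π).transpose * G * signedPerm s π) i j =
      ((s i * s j : ℤˣ) : ℤ) * G (π i) (π j) := by
  simp [Matrix.mul_apply, signedPerm]
  ring

theorem signedPerm_transpose_mul_self {d : ℕ} (s : Fin d → ℤˣ) (π : Equiv.Perm (Fin d)) :
    (signedPerm s π).transpose * signedPerm s π = 1 := by
  ext i j
  have := signedPerm_conj_apply s π 1 i j
  rw [Matrix.mul_one] at this
  rw [this]
  rcases eq_or_ne i j with rfl | hij
  · simp
  · simp [hij]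

theorem sum_signs_mul_eq_zero {d : ℕ} {i j : Fin d} (hij : i ≠ j) :
    ∑ s : Fin d → ℤˣ, (((s i * s j : ℤˣ) : ℤ) : ℝ) = 0 := by
  -- Flipping the sign `s i` negates every summand, so the sum is its own negative.
  have h := Fintype.sum_equiv (Equiv.mulLeft (Pi.mulSingle i (-1) : Fin d → ℤˣ))
    (fun s ↦ -(((s i * s j : ℤˣ) : ℤ) : ℝ)) (fun s ↦ (((s i * s j : ℤˣ) : ℤ) : ℝ))
    (fun s ↦ by simp [hij.symm])
  rw [Finset.sum_neg_distrib] at h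
  linarith

/-- Signs kill the off-diagonal entries. Cyclic shifts, being simply transitive, turn each diagonal
entry into the trace. -/
theorem sum_signedPerm_conj {d : ℕ} [NeZero d] (G : Matrix (Fin d) (Fin d) ℝ) :
    ∑ x : (Fin d → ℤˣ) × Fin d, (signedPerm x.1 (Equiv.addRight x.2)).transpose * G *
      signedPerm x.1 (Equiv.addRight x.2) =
    ((Fintype.card (Fin d → ℤˣ) : ℝ) * G.trace) • (1 : Matrix (Fin d) (Fin d) ℝ) := by
  ext i j
  simp only [Matrix.sum_apply, signedPerm_conj_apply, Fintype.sum_prod_type, Matrix.smul_apply]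
  simp_rw [← Finset.mul_sum]
  rw [← Finset.sum_mul]
  rcases eq_or_ne i j with rfl | hij
  · have : ∑ k, G (i + k) (i + k) = G.trace :=
      Fintype.sum_equiv (Equiv.addLeft i) _ _ fun k ↦ rfl
    simp [this]
  · rw [sum_signs_mul_eq_zero hij]
    simp [hij]

/-- Averaging over signed cyclic shifts replaces a matrix by a multiple of the identity. -/
theorem robustRisk_trace_smul_one_le {d : ℕ} (hd : 0 < d) (σc σz : ℝ) {ε : ℝ} (hε : 0 ≤ ε)
    (G : Matrix (Fin d) (Fin d) ℝ) :
    robustRisk (1 : Matrix (Fin d) (Fin d) ℝ) σc σz ε (linEst ((G.trace / d) • (1 : Matrix (Fin d) (Fin d) ℝ))) ≤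
      robustRisk (1 : Matrix (Fin d) (Fin d) ℝ) σc σz ε (linEst G) := by
  have : NeZero d := ⟨hd.ne'⟩
  set N : ℝ := (Fintype.card (Fin d → ℤˣ) : ℝ) with hN
  have hN0 : 0 < N := by rw [hN]; exact_mod_cast Fintype.card_pos
  have hd' : (0 : ℝ) < d := by exact_mod_cast hd
  have hw : ∑ _x : (Fin d → ℤˣ) × Fin d, (N * d)⁻¹ = 1 := by
    rw [Finset.sum_const, Finset.card_univ, Fintype.card_prod, Fintype.card_fin, nsmul_eq_mul,
      Nat.cast_mul, ← hN]
    field_simp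
  have h := (convexOn_robustRisk (1 : Matrix (Fin d) (Fin d) ℝ) σc σz hε).map_sum_le
    (t := Finset.univ) (w := fun _ : (Fin d → ℤˣ) × Fin d ↦ (N * d)⁻¹)
    (p := fun x ↦ (signedPerm x.1 (Equiv.addRight x.2)).transpose * G *
      signedPerm x.1 (Equiv.addRight x.2)) (fun _ _ ↦ by positivity) hw (fun _ _ ↦ Set.mem_univ _)
  rw [← Finset.smul_sum, sum_signedPerm_conj, smul_smul, ← hN,
    show (N * d)⁻¹ * (N * G.trace) = G.trace / d by field_simp] at h
  refine h.trans ?_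
  calc _ ≤ ∑ _x : (Fin d → ℤˣ) × Fin d, (N * d)⁻¹ •
        robustRisk (1 : Matrix (Fin d) (Fin d) ℝ) σc σz ε (linEst G) := by
        refine Finset.sum_le_sum fun x _ ↦ smul_le_smul_of_nonneg_left ?_ (by positivity)
        exact robustRisk_conj_le (signedPerm_transpose_mul_self _ _) σc σz hε G
    _ = _ := by rw [← Finset.sum_smul, hw, one_smul]

/-! ### The risk of scaled projections -/

/-- The robust risk of the scaled projection `a U Uᵀ` in dimension `d`. -/
noncomputable def projectionRisk (d : ℕ) (σc τ ε a : ℝ) : ℝ :=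
  shrinkageVariance σc τ a +
    2 * (ε * |a|) * (√(shrinkageVariance σc τ a) * meanNormRatio d) + (ε * |a|) ^ 2

theorem robustRisk_smul_projection {n d : ℕ} (hd : 0 < d) {U : Matrix (Fin n) (Fin d) ℝ}
    (hU : U.transpose * U = 1) (σc σz : ℝ) {ε : ℝ} (hε : 0 ≤ ε) (a : ℝ) :
    robustRisk U σc σz ε (linEst (a • (U * U.transpose))) =
      projectionRisk d σc (σz * √((d : ℝ) / n)) ε a := by
  have hmU : Measurable (Prod.map (id : EuclideanSpace ℝ (Fin d) → EuclideanSpace ℝ (Fin d))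
      (Matrix.toEuclideanLin U.transpose)) :=
    measurable_id.prodMap (continuous_toEuclideanLin _).measurable
  have h1 := integral_map (μ := modelLaw n d σc σz) hmU.aemeasurable
    (f := fun p ↦ (‖(a - 1) • p.1 + a • p.2‖ + ε * |a|) ^ 2) (by fun_prop)
  rw [modelLaw_map_transpose hd hU, modelLaw] at h1
  have h2 := integral_map (μ := (isoGaussian d (σc ^ 2 / d)).prod
      (isoGaussian d ((σz * √((d : ℝ) / n)) ^ 2 / d)))
    (φ := fun p ↦ (a - 1) • p.1 + a • p.2) (by fun_prop)
    (f := fun x ↦ (‖x‖ + ε * |a|) ^ 2) (by fun_prop)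
  rw [isoGaussian_prod_map_add (by positivity) (by positivity), h1] at h2
  rw [robustRisk, projectionRisk,
    ← integral_norm_add_const_sq_isoGaussian hd (shrinkageVariance_nonneg _ _ _)]
  simp_rw [worstCaseError_smul_projection hd hU hε]
  simp only [Prod.map_fst, Prod.map_snd, id_eq] at h2
  rw [← h2]
  congr 2
  rw [shrinkageVariance]
  ring

/-- The scaled projections are optimal. -/
theorem projectionRisk_le_robustRisk {n d : ℕ} (hd : 0 < d) {U : Matrix (Fin n) (Fin d) ℝ}
    (hU : U.transpose * U = 1) (σc σz : ℝ) {ε : ℝ} (hε : 0 ≤ ε) (H : Matrix (Fin n) (Fin n) ℝ) :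
    projectionRisk d σc (σz * √((d : ℝ) / n)) ε ((U.transpose * H * U).trace / d) ≤
      robustRisk U σc σz ε (linEst H) := by
  refine le_trans (le_of_eq ?_) ((robustRisk_trace_smul_one_le hd σc _ hε _).trans
    (robustRisk_compression_le hd hU σc σz hε H))
  have := robustRisk_smul_projection hd (U := (1 : Matrix (Fin d) (Fin d) ℝ)) (by simp) σc
    (σz * √((d : ℝ) / n)) hε ((U.transpose * H * U).trace / d)
  rw [Matrix.transpose_one, Matrix.mul_one, div_self (by positivity), Real.sqrt_one, mul_one]
    at this
  exact this.symm

/-! ### Strict convexity of the robust risk -/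

theorem ae_bounded_false_of_gaussianReal {v : NNReal} (hv : v ≠ 0) (C : ℝ) :
    ¬ ∀ᵐ t ∂(gaussianReal 0 v), |t| ≤ C := by
  intro h
  have h' := (gaussianReal_absolutelyContinuous' 0 hv).ae_le h
  have hle : volume (Set.Ioi C) ≤ volume {t : ℝ | ¬ |t| ≤ C} :=
    measure_mono fun t ht hle ↦ (not_lt.2 ((le_abs_self t).trans hle)) ht
  rw [show volume {t : ℝ | ¬ |t| ≤ C} = 0 from h', Real.volume_Ioi] at hle
  simp at hle

theorem isoGaussian_map_inner {k : ℕ} {v : ℝ} (hv : 0 ≤ v) (u : EuclideanSpace ℝ (Fin k)) :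
    (isoGaussian k v).map (fun z ↦ inner ℝ u z) = gaussianReal 0 (v * ‖u‖ ^ 2).toNNReal := by
  have hm : Measurable (fun z : EuclideanSpace ℝ (Fin k) ↦ (inner ℝ u z : ℝ)) := by fun_prop
  have := Measure.isProbabilityMeasure_map (μ := isoGaussian k v) hm.aemeasurable
  refine Measure.ext_of_charFun (funext fun t ↦ ?_)
  have h : charFun ((isoGaussian k v).map (fun z ↦ inner ℝ u z)) t =
      charFun (isoGaussian k v) (t • u) := by
    rw [charFun_apply, charFun_apply, integral_map hm.aemeasurable (by fun_prop)]
    simp_rw [real_inner_smul_right, real_inner_comm u]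
    simp
  rw [h, charFun_isoGaussian k hv, charFun_gaussianReal, norm_smul, mul_pow, Real.norm_eq_abs,
    sq_abs, Real.coe_toNNReal _ (by positivity)]
  congr 1
  push_cast
  ring

/-- If `u = Aᵀy ≠ 0`, then `⟨u, z⟩ = ⟨y, Az⟩` is a nondegenerate real Gaussian, hence unbounded. -/
theorem toEuclideanLin_unbounded_isoGaussian {k : ℕ} {v : ℝ} (hv : 0 < v)
    {A : Matrix (Fin k) (Fin k) ℝ} (hA : A ≠ 0) (C : ℝ) :
    ¬ ∀ᵐ z ∂(isoGaussian k v), ‖Matrix.toEuclideanLin A z‖ ≤ C := by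
  intro h
  obtain ⟨y, hy⟩ : ∃ y, Matrix.toEuclideanLin A.transpose y ≠ 0 := by
    by_contra! hy
    have : A.transpose = 0 := Matrix.toEuclideanLin.injective (by ext1 y; simpa using hy y)
    exact hA (by simpa using this)
  set u := Matrix.toEuclideanLin A.transpose y with hu
  have hv' : (v * ‖u‖ ^ 2).toNNReal ≠ 0 := by
    rw [Ne, Real.toNNReal_eq_zero, not_le]
    have := norm_pos_iff.2 hy
    positivity
  refine ae_bounded_false_of_gaussianReal hv' (‖y‖ * C) ?_
  rw [← isoGaussian_map_inner hv.le u, ae_map_iff (by fun_prop)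
    (measurableSet_le (by fun_prop) (by fun_prop))]
  filter_upwards [h] with z hz
  rw [hu, inner_toEuclideanLin_left, Matrix.transpose_transpose]
  exact (abs_real_inner_le_norm _ _).trans (mul_le_mul_of_nonneg_left hz (norm_nonneg _))

/-- Equality would make the convexity defect vanish almost surely: `(G - H)(x + z + e) = 0` with
`‖e‖ ≤ ε`. For a fixed `c` this bounds `(G - H)z` for almost every `z`, which is impossible. -/
theorem robustRisk_midpoint_lt {n d : ℕ} (hn : 0 < n) (U : Matrix (Fin n) (Fin d) ℝ) (σc : ℝ)
    {σz ε : ℝ} (hσz : 0 < σz) (hε : 0 ≤ ε) {G H : Matrix (Fin n) (Fin n) ℝ} (hGH : G ≠ H) :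
    robustRisk U σc σz ε (linEst ((1 / 2 : ℝ) • G + (1 / 2 : ℝ) • H)) <
      (1 / 2) * robustRisk U σc σz ε (linEst G) + (1 / 2) * robustRisk U σc σz ε (linEst H) := by
  have hG := worstCaseError_integrable U σc σz hε G
  have hH := worstCaseError_integrable U σc σz hε H
  have hM := worstCaseError_integrable U σc σz hε ((1 / 2 : ℝ) • G + (1 / 2 : ℝ) • H)
  have key (x z : EuclideanSpace ℝ (Fin n)) := worstCaseError_combo_le hε (s := 1 / 2)
    (t := 1 / 2) (by norm_num) (by norm_num) (by norm_num) G H x z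
  simp only [robustRisk]
  rw [← integral_const_mul, ← integral_const_mul,
    ← integral_add (hG.const_mul _) (hH.const_mul _)]
  have hle : ∀ p : EuclideanSpace ℝ (Fin d) × EuclideanSpace ℝ (Fin n), worstCaseError ε
      (linEst ((1 / 2 : ℝ) • G + (1 / 2 : ℝ) • H)) (Matrix.toEuclideanLin U p.1) p.2 ≤
      1 / 2 * worstCaseError ε (linEst G) (Matrix.toEuclideanLin U p.1) p.2 +
        1 / 2 * worstCaseError ε (linEst H) (Matrix.toEuclideanLin U p.1) p.2 := fun p ↦ by
    obtain ⟨e, -, he⟩ := key (Matrix.toEuclideanLin U p.1) p.2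
    exact he.trans (sub_le_self _ (by positivity))
  refine lt_of_le_of_ne (integral_mono hM ((hG.const_mul _).add (hH.const_mul _)) hle) fun heq ↦ ?_
  have hae := (integral_eq_iff_of_ae_le hM ((hG.const_mul _).add (hH.const_mul _))
    (ae_of_all _ hle)).1 heq
  obtain ⟨A, hA0, hA⟩ : ∃ A : ℝ, 0 ≤ A ∧ ∀ v, ‖Matrix.toEuclideanLin (G - H) v‖ ≤ A * ‖v‖ :=
    ⟨‖LinearMap.toContinuousLinearMap (Matrix.toEuclideanLin (G - H))‖, norm_nonneg _,
      (LinearMap.toContinuousLinearMap (Matrix.toEuclideanLin (G - H))).le_opNorm⟩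
  rw [modelLaw] at hae
  obtain ⟨c, hc⟩ := (Measure.ae_ae_of_ae_prod hae).exists
  have hn' : (0 : ℝ) < n := by exact_mod_cast hn
  refine toEuclideanLin_unbounded_isoGaussian (k := n) (v := σz ^ 2 / n) (by positivity)
    (sub_ne_zero.2 hGH) (A * (‖Matrix.toEuclideanLin U c‖ + ε)) ?_
  filter_upwards [hc] with z hz
  obtain ⟨e, he, hes⟩ := key (Matrix.toEuclideanLin U c) z
  have hzero : Matrix.toEuclideanLin (G - H) (Matrix.toEuclideanLin U c + z + e) = 0 := by
    simp only [Pi.add_apply] at hz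
    rw [linEst_apply (G - H)] at hes
    rw [← norm_eq_zero]
    refine pow_eq_zero_iff two_ne_zero |>.1 (le_antisymm ?_ (by positivity))
    linarith
  have : Matrix.toEuclideanLin (G - H) z =
      -Matrix.toEuclideanLin (G - H) (Matrix.toEuclideanLin U c + e) := by
    rw [eq_neg_iff_add_eq_zero, ← map_add, ← hzero]
    congr 1
    abel
  rw [this, norm_neg]
  refine (hA _).trans (mul_le_mul_of_nonneg_left ((norm_add_le _ _).trans ?_) hA0)
  gcongr

/-! ### Asymptotics -/

/-- Only the cross term carries the factor `meanNormRatio d`; the two squares carry `1`, which is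
larger or equal. -/
theorem mul_limitRisk_le_projectionRisk (d : ℕ) (σc τ ε a : ℝ) :
    meanNormRatio d * limitRisk σc τ ε a ≤ projectionRisk d σc τ ε a := by
  rw [limitRisk, projectionRisk]
  have h := Real.sq_sqrt (shrinkageVariance_nonneg σc τ a)
  have h1 := meanNormRatio_le_one d
  set s := √(shrinkageVariance σc τ a)
  rw [← h]
  nlinarith [mul_nonneg (sub_nonneg.2 h1) (sq_nonneg s),
    mul_nonneg (sub_nonneg.2 h1) (sq_nonneg (ε * |a|))]

theorem projectionRisk_le_limitRisk (d : ℕ) (σc τ : ℝ) {ε : ℝ} (hε : 0 ≤ ε) (a : ℝ) :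
    projectionRisk d σc τ ε a ≤ limitRisk σc τ ε a := by
  rw [limitRisk, projectionRisk]
  have h := Real.sq_sqrt (shrinkageVariance_nonneg σc τ a)
  have h1 := meanNormRatio_le_one d
  have h2 : 0 ≤ √(shrinkageVariance σc τ a) := Real.sqrt_nonneg _
  set s := √(shrinkageVariance σc τ a)
  rw [← h]
  nlinarith [mul_nonneg (sub_nonneg.2 h1) (mul_nonneg (mul_nonneg hε (abs_nonneg a)) h2)]

theorem exists_isMinOn_projectionRisk (d : ℕ) (σc : ℝ) {τ ε : ℝ} (hτ : 0 < τ) (hε : 0 ≤ ε) :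
    ∃ a, ∀ b, projectionRisk d σc τ ε a ≤ projectionRisk d σc τ ε b := by
  have hcont : Continuous (projectionRisk d σc τ ε) := by
    unfold projectionRisk shrinkageVariance
    fun_prop
  refine hcont.exists_forall_le ?_
  have hlb (a : ℝ) : τ ^ 2 * ‖a‖ ^ 2 ≤ projectionRisk d σc τ ε a := by
    have := meanNormRatio_nonneg d
    have h : 0 ≤ 2 * (ε * |a|) * (√(shrinkageVariance σc τ a) * meanNormRatio d) +
      (ε * |a|) ^ 2 := by positivity
    rw [projectionRisk, Real.norm_eq_abs, sq_abs]
    nlinarith [sq_nonneg ((a - 1) * σc), show shrinkageVariance σc τ a =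
      (a - 1) ^ 2 * σc ^ 2 + a ^ 2 * τ ^ 2 from rfl]
  refine Filter.tendsto_atTop_mono hlb (Filter.Tendsto.const_mul_atTop (by positivity) ?_)
  exact (Filter.tendsto_pow_atTop two_ne_zero).comp (tendsto_norm_cocompact_atTop)

theorem theorem1 (σc σz ε : ℝ) (hσc : 0 ≤ σc) (hσz : 0 ≤ σz) (hε : 0 ≤ ε) :
    -- the scaled projection is asymptotically risk-optimal among the symmetric linear estimators
    (∀ δ : ℝ, 0 < δ → ∃ D : ℕ, ∀ d n : ℕ, D ≤ d → d ≤ n →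
      ∀ U : Matrix (Fin n) (Fin d) ℝ, U.transpose * U = 1 →
        ∀ H : Matrix (Fin n) (Fin n) ℝ, H.IsSymm →
          robustRisk U σc σz ε (linEst (shrinkage σc σz ε ((d : ℝ) / n) • (U * U.transpose)))
            ≤ robustRisk U σc σz ε (linEst H) + δ) ∧
    -- the unique minimizer is a scaled projection whose factor converges to the stated one
    (0 < σz → ∀ δ : ℝ, 0 < δ → ∀ K : ℝ, ∃ D : ℕ, ∀ d n : ℕ, D ≤ d → d ≤ n →
      (ε ≠ σc ∨ (n : ℝ) ≤ K * d) →
      ∀ U : Matrix (Fin n) (Fin d) ℝ, U.transpose * U = 1 →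
        ∃ a : ℝ, |a - shrinkage σc σz ε ((d : ℝ) / n)| ≤ δ ∧
          ∀ H : Matrix (Fin n) (Fin n) ℝ, H.IsSymm → H ≠ a • (U * U.transpose) →
            robustRisk U σc σz ε (linEst (a • (U * U.transpose)))
              < robustRisk U σc σz ε (linEst H)) := by
  have hev (η : ℝ) (hη : 0 < η) : ∃ D : ℕ, ∀ d : ℕ, D ≤ d →
      0 < d ∧ (1 - meanNormRatio d) * σc ^ 2 ≤ η := by
    have ht : Filter.Tendsto (fun d ↦ (1 - meanNormRatio d) * σc ^ 2) Filter.atTop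
        (nhds ((1 - 1) * σc ^ 2)) :=
      (tendsto_const_nhds.sub tendsto_meanNormRatio).mul_const _
    rw [sub_self, zero_mul] at ht
    exact Filter.eventually_atTop.1 ((Filter.eventually_gt_atTop 0).and
      ((ht.eventually_lt_const hη).mono fun _ ↦ le_of_lt))
  have hlim (r : ℝ) (hr : 0 ≤ r) :
      limitRisk σc (σz * √r) ε (shrinkage σc σz ε r) ≤ σc ^ 2 := by
    rw [← limitRisk_zero hσc (σz * √r) ε]
    exact limitRisk_shrinkage_le hσc hσz hε hr 0
  have hsub (d : ℕ) (r : ℝ) (hr : 0 ≤ r) : (1 - meanNormRatio d) *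
      limitRisk σc (σz * √r) ε (shrinkage σc σz ε r) ≤ (1 - meanNormRatio d) * σc ^ 2 :=
    mul_le_mul_of_nonneg_left (hlim r hr) (sub_nonneg.2 (meanNormRatio_le_one d))
  refine ⟨fun δ hδ ↦ ?_, fun hσz0 δ hδ K ↦ ?_⟩
  · obtain ⟨D, hD⟩ := hev δ hδ
    refine ⟨D, fun d n hDd _ U hU H _ ↦ ?_⟩
    obtain ⟨hd, hκ⟩ := hD d hDd
    have hr : 0 ≤ (d : ℝ) / n := by positivity
    rw [robustRisk_smul_projection hd hU σc σz hε]
    set α := shrinkage σc σz ε ((d : ℝ) / n)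
    -- With `b = tr(UᵀHU)/d`: `P(α) ≤ L(α) ≤ κL(b) + (1-κ)L(α) ≤ P(b) + δ`.
    have h1 := projectionRisk_le_limitRisk d σc (σz * √((d : ℝ) / n)) hε α
    have h2 := mul_limitRisk_le_projectionRisk d σc (σz * √((d : ℝ) / n)) ε
      ((U.transpose * H * U).trace / d)
    have h3 := mul_le_mul_of_nonneg_left (limitRisk_shrinkage_le hσc hσz hε hr
      ((U.transpose * H * U).trace / d)) (meanNormRatio_nonneg d)
    have h4 := projectionRisk_le_robustRisk hd hU σc σz hε H
    have h5 := hsub d _ hr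
    linarith
  · obtain ⟨C, hC, hgrowth⟩ := exists_quadratic_growth hσc hσz0 hε K
    -- For a minimizer `a` of `P`, `κC(a-α)² ≤ κ(L(a) - L(α)) ≤ P(α) - κL(α) ≤ (1-κ)σc²`. With `κ ≥
    -- 1/2`, the threshold `Cδ²/2` yields `|a-α| ≤ δ`.
    obtain ⟨D₁, hD₁⟩ := hev (C * δ ^ 2 / 2) (by positivity)
    obtain ⟨D₂, hD₂⟩ := Filter.eventually_atTop.1
      (tendsto_meanNormRatio.eventually_const_le (show (1 / 2 : ℝ) < 1 by norm_num))
    refine ⟨max D₁ D₂, fun d n hDd hdn hK U hU ↦ ?_⟩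
    obtain ⟨hd, hκ⟩ := hD₁ d ((le_max_left _ _).trans hDd)
    have hκ2 := hD₂ d ((le_max_right _ _).trans hDd)
    have hn : 0 < n := hd.trans_le hdn
    have hd' : (0 : ℝ) < d := by exact_mod_cast hd
    have hn' : (0 : ℝ) < n := by exact_mod_cast hn
    have hr : 0 < (d : ℝ) / n := by positivity
    obtain ⟨a, ha⟩ := exists_isMinOn_projectionRisk d σc
      (mul_pos hσz0 (Real.sqrt_pos.2 hr)) hε
    refine ⟨a, ?_, fun H _ hH ↦ ?_⟩
    · have h1 := hgrowth _ hr.le (hK.imp_right fun h ↦ by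
        rw [← mul_div_assoc, le_div_iff₀ hn']; linarith) a
      have h2 := ha (shrinkage σc σz ε ((d : ℝ) / n))
      set α := shrinkage σc σz ε ((d : ℝ) / n)
      have h3 := projectionRisk_le_limitRisk d σc (σz * √((d : ℝ) / n)) hε α
      have h4 := mul_limitRisk_le_projectionRisk d σc (σz * √((d : ℝ) / n)) ε a
      have h5 := hsub d _ hr.le
      have h6 : meanNormRatio d * (C * (a - α) ^ 2) ≤ C * δ ^ 2 / 2 := by
        have := mul_le_mul_of_nonneg_left h1 (meanNormRatio_nonneg d)
        linarith
      have h7 : (a - α) ^ 2 ≤ δ ^ 2 := by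
        have h8 := mul_le_mul_of_nonneg_right hκ2 (show 0 ≤ C * (a - α) ^ 2 by positivity)
        refine le_of_mul_le_mul_left (?_ : C * (a - α) ^ 2 ≤ C * δ ^ 2) hC
        linarith
      exact abs_le_of_sq_le_sq h7 hδ.le
    · by_contra! hle
      have h1 := robustRisk_midpoint_lt hn U σc hσz0 hε hH
      -- The midpoint would have risk below `P(a)`, yet its risk is at least `P` at its own
      -- normalized trace.
      set M := (1 / 2 : ℝ) • H + (1 / 2 : ℝ) • (a • (U * U.transpose))
      have h2 := projectionRisk_le_robustRisk hd hU σc σz hε M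
      have h3 := ha ((U.transpose * M * U).trace / d)
      rw [robustRisk_smul_projection hd hU σc σz hε] at hle h1
      linarith
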